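/- \textbf{Programs.} A ground program with aggregates $P$ has a finite set $F_P$ of constants (integers or other names), a finite set of predicate symbols with arities, and finitely many ground rules $$A \leftarrow C_1,\dots,C_m,\,A_1,\dots,A_n,\,\mathit{not}\,B_1,\dots,\mathit{not}\,B_k ,$$ where $A,A_i,B_i$ are ground atoms over these symbols and each $C_i$ is a ground aggregate atom $\mathit{aggr}(s)\ \mathtt{op}\ v$. Here $\mathit{aggr}$ is an aggregate function symbol, $\mathtt{op}\in\{=,\neq,<,>,\le,\ge\}$, $v\in\mathbb Z\cap F_P$, and $s$ is an intensional set $\{X\mid p(\dots)\}$, the arguments of $p$ being constants of $F_P$ or $X$, or an intensional multiset $\{\!\{X\mid\exists \bar Z.\,p(\dots)\}\!\}$, the arguments being constants of $F_P$, $X$, or the variables $\bar Z$; all the named variables occur in $p(\dots)$. An interpretation is a set $I$ of ground atoms over the symbols of $P$. The value of $s$ in $I$ is the set of all $a \in F_P$ such that the instance $X/a$ of $p(\dots)$ is in $I$, respectively the multiset in which $a$ occurs once for every substitution of $\bar Z$ by constants of $F_P$ which together with $X/a$ gives an atom in $I$. Each aggregate function symbol has a fixed interpretation as a map from finite sets and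 finite multisets of constants to $\mathbb Z$; this determines when $I\models\ell$ for an aggregate atom $\ell$. \textbf{Fixpoint answer sets.} Let $\mathcal H(\ell)$ be the set of atoms formed from the predicate of $\ell$ and constants of $F_P$. A pair $\langle S_1,S_2\rangle$ of disjoint subsets of $\mathcal H(\ell)$ is a solution of $\ell$ if $I\models\ell$ for every interpretation $I$ with $S_1\subseteq I$ and $S_2\cap I=\emptyset$. For interpretations $M$, $I$ let $K^P_M(I)$ be the set of heads of those rules of $P$ (in the notation above) for which no $B_i$ is in $M$, all $A_i$ are in $I$, and $\langle I\cap M\cap\mathcal H(C_i),\ \mathcal H(C_i)\setminus M\rangle$ is a solution of $C_i$ for all $i$. An interpretation $M$ is a fixpoint answer set of $P$ if $M$ is the least fixpoint of the (monotone) operator $K_M^P$. \textbf{Complexity.} For a language $O$, $\mathbf{P}^O$ and $\mathbf{NP}^O$ are the classes of languages decidable in polynomial time, respectively having polynomially bounded certificates that are verifiable in polynomial time, by machines with oracle $O$. For a class $C$ of languages, $\mathbf{NP}^C=\bigcup_{O\in C}\mathbf{NP}^O$, and $\textbf{co-NP}^C$ consists of the complements of the languages in $\mathbf{NP}^C$.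 Instances are finite objects in a standard encoding (numbers in binary, finite sets as lists), and their size is the length of the encoding. A set $\mathcal Q$ of ground programs is called $C$-decidable if there is a language $A\in C$ such that for all $P\in\mathcal Q$, all aggregate atoms $\ell$ occurring in $P$ and all interpretations $M$ of $P$, the encoding of $(\ell,M)$ (for every listing of $M$) belongs to $A$ if and only if $M\models\ell$. \textbf{Statement.} Let $C$ be any class of languages, fix any interpretation of the aggregate function symbols, and let $\mathcal Q$ be a $C$-decidable set of ground programs with aggregates. Then the problem ``given $P\in\mathcal Q$, determine whether $P$ has a fixpoint answer set'' is in $\mathbf{NP}^{\textbf{co-NP}^C}$: there is a language $L\in\mathbf{NP}^{\textbf{co-NP}^C}$ such that for every $P\in\mathcal Q$, the encoding of $P$ is in $L$ if and only if $P$ has a fixpoint answer set. -/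

import Mathlib

/-! ### Machine model: while-programs on binary trees, with an oracle and a step count

Instances of decision problems are binary trees (S-expressions over one atom `nil`).
A machine has registers holding binary trees. Every instruction that creates or queries a
value is charged the size of that value, so every value that occurs has size at most
input size + running time; hence polynomial time here is ordinary
(oracle) Turing-machine polynomial time. -/

/-- Binary trees. -/
inductive Sexp : Type
  | nil : Sexp
  | cons : Sexp → Sexp → Sexp

/-- Number of nodes of a tree (leaves included): the length of an instance. -/
def Sexp.size : Sexp → ℕ
  | .nil => 1
  | .cons a b => 1 + a.size + b.size

/-- Left component, `nil` for `nil`. -/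
def Sexp.hd : Sexp → Sexp
  | .nil => .nil
  | .cons a _ => a

/-- Right component, `nil` for `nil`. -/
def Sexp.tl : Sexp → Sexp
  | .nil => .nil
  | .cons _ b => b

/-- `false` is coded by `nil`, `true` by `(nil . nil)`. -/
def Sexp.ofBool : Bool → Sexp
  | false => .nil
  | true => .cons .nil .nil

/-- A language is a set of instances. -/
abbrev Lang := Set Sexp

/-- Oracle while-programs; registers are numbered by natural numbers. -/
inductive Cmd : Type
  | setNil (x : ℕ) : Cmd
  | copy (x y : ℕ) : Cmd
  | cons (x y z : ℕ) : Cmd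
  | hd (x y : ℕ) : Cmd
  | tl (x y : ℕ) : Cmd
  | query (x y : ℕ) : Cmd
  | seq (c d : Cmd) : Cmd
  | ite (x : ℕ) (c d : Cmd) : Cmd
  | loop (x : ℕ) (c : Cmd) : Cmd

/-- Contents of the registers. -/
abbrev Store := ℕ → Sexp

open Classical in
/-- `Exec O c s t s'`: with oracle `O`, the program `c` started in `s` halts in `s'`
after `t` steps. The test of `ite` and `loop` is "register `x` is not `nil`";
`query x y` stores in `x` the truth value of "the content of `y` belongs to `O`". -/
inductive Exec (O : Lang) : Cmd → Store → ℕ → Store → Prop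
  | setNil (x : ℕ) (s : Store) : Exec O (.setNil x) s 1 (Function.update s x .nil)
  | copy (x y : ℕ) (s : Store) :
      Exec O (.copy x y) s (1 + (s y).size) (Function.update s x (s y))
  | cons (x y z : ℕ) (s : Store) :
      Exec O (.cons x y z) s (1 + (Sexp.cons (s y) (s z)).size)
        (Function.update s x (Sexp.cons (s y) (s z)))
  | hd (x y : ℕ) (s : Store) :
      Exec O (.hd x y) s (1 + (s y).hd.size) (Function.update s x (s y).hd)
  | tl (x y : ℕ) (s : Store) :
      Exec O (.tl x y) s (1 + (s y).tl.size) (Function.update s x (s y).tl)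
  | query (x y : ℕ) (s : Store) :
      Exec O (.query x y) s (1 + (s y).size)
        (Function.update s x (Sexp.ofBool (decide (s y ∈ O))))
  | seq {c d : Cmd} {s s' s'' : Store} {t t' : ℕ} :
      Exec O c s t s' → Exec O d s' t' s'' → Exec O (.seq c d) s (t + t') s''
  | iteTrue {x : ℕ} {c d : Cmd} {s s' : Store} {t : ℕ} :
      s x ≠ .nil → Exec O c s t s' → Exec O (.ite x c d) s (1 + t) s'
  | iteFalse {x : ℕ} {c d : Cmd} {s s' : Store} {t : ℕ} :
      s x = .nil → Exec O d s t s' → Exec O (.ite x c d) s (1 + t) s'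
  | loopStop {x : ℕ} {c : Cmd} {s : Store} :
      s x = .nil → Exec O (.loop x c) s 1 s
  | loopStep {x : ℕ} {c : Cmd} {s s' s'' : Store} {t t' : ℕ} :
      s x ≠ .nil → Exec O c s t s' → Exec O (.loop x c) s' t' s'' →
      Exec O (.loop x c) s (1 + t + t') s''

/-- The input is placed in register `0`, all other registers hold `nil`. -/
def initStore (x : Sexp) : Store := Function.update (fun _ => Sexp.nil) 0 x

/-- The class `P^O`: some program with oracle `O` halts on every input within a number of
steps polynomial in the input size, and accepts (register `0` is not `nil`) exactly the
members of the language. -/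
def PWith (O : Lang) : Set Lang :=
  {R | ∃ (c : Cmd) (p : Polynomial ℕ), ∀ x : Sexp, ∃ (t : ℕ) (s : Store),
    Exec O c (initStore x) t s ∧ t ≤ p.eval x.size ∧ (s 0 ≠ Sexp.nil ↔ x ∈ R)}

/-- The class `NP^O`: polynomially bounded certificates, checked in `P^O`. -/
def NPWith (O : Lang) : Set Lang :=
  {L | ∃ R ∈ PWith O, ∃ q : Polynomial ℕ, ∀ x : Sexp,
    x ∈ L ↔ ∃ w : Sexp, w.size ≤ q.eval x.size ∧ Sexp.cons x w ∈ R}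

/-- `NP^𝒞` for a class `𝒞` of languages: the union of `NP^O` over `O ∈ 𝒞`. -/
def NPRel (𝒞 : Set Lang) : Set Lang := {L | ∃ O ∈ 𝒞, L ∈ NPWith O}

/-- `co-NP^𝒞`: the complements of the languages in `NP^𝒞`. -/
def coNPRel (𝒞 : Set Lang) : Set Lang := {L | Lᶜ ∈ NPRel 𝒞}

/-! ### Syntax of ground programs with aggregates -/

/-- Constants: the integers, and further names. -/
inductive Const : Type
  | int (z : ℤ) : Const
  | sym (n : ℕ) : Const
  deriving DecidableEq

/-- A ground atom `p(t₁,…,tₙ)`; its predicate symbol is the pair (name, arity). -/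
structure Atom where
  pred : ℕ
  args : List Const

/-- An argument in the defining atom of an intensional set or multiset which has no free
variable: a constant, the grouped variable, or a local variable. -/
inductive PTerm : Type
  | const (c : Const) : PTerm
  | grouped : PTerm
  | loc (j : ℕ) : PTerm

/-- The intensional set `{X | p(Y₁,…,Yₘ)}` (`multi = false`), or the intensional multiset
`{{X | ∃ Z₁,…,Zᵣ. p(Y₁,…,Yₘ)}}` (`multi = true`), where `X` is the grouped variable and
`Z₁,…,Zᵣ` are the local variables that occur among the `Yᵢ`. -/
structure ISet where
  multi : Bool
  pred : ℕ
  args : List PTerm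

/-- The relational operators `=, ≠, <, >, ≤, ≥`. -/
inductive RelOp : Type
  | eq | ne | lt | gt | le | ge

/-- A ground aggregate atom `aggr(s) op result`. -/
structure AggAtom where
  fn : ℕ
  iset : ISet
  op : RelOp
  result : ℤ

/-- A ground rule `head ← agg, pos, not neg`. -/
structure Rule where
  head : Atom
  agg : List AggAtom
  pos : List Atom
  neg : List Atom

/-- Ground atoms over given predicate symbols and constants. -/
def Atom.Over (a : Atom) (preds : List (ℕ × ℕ)) (consts : List Const) : Prop :=
  (a.pred, a.args.length) ∈ preds ∧ ∀ c ∈ a.args, c ∈ consts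

/-- The grouped variable occurs in the defining atom, an intensional set has no local
variables, and all symbols are from the program signature. -/
def ISet.Over (s : ISet) (preds : List (ℕ × ℕ)) (consts : List Const) : Prop :=
  (s.pred, s.args.length) ∈ preds ∧ PTerm.grouped ∈ s.args ∧
    (s.multi = false → ∀ j, PTerm.loc j ∉ s.args) ∧
    ∀ c, PTerm.const c ∈ s.args → c ∈ consts

def AggAtom.Over (l : AggAtom) (preds : List (ℕ × ℕ)) (consts : List Const) : Prop :=
  l.iset.Over preds consts ∧ Const.int l.result ∈ consts

def Rule.Over (r : Rule) (preds : List (ℕ × ℕ)) (consts : List Const) : Prop :=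
  r.head.Over preds consts ∧ (∀ l ∈ r.agg, l.Over preds consts) ∧
    (∀ a ∈ r.pos, a.Over preds consts) ∧ ∀ a ∈ r.neg, a.Over preds consts

/-- A ground program with aggregates, together with its finite signature: the constants
(which form the Herbrand universe) and the predicate symbols (name, arity). -/
structure Program where
  consts : List Const
  preds : List (ℕ × ℕ)
  rules : List Rule
  rules_over : ∀ r ∈ rules, r.Over preds consts

/-- The Herbrand base. -/
def Program.base (P : Program) : Set Atom := {a | a.Over P.preds P.consts}

/-- `ℓ` is one of the aggregate atoms occurring in the program. -/
def Program.HasAgg (P : Program) (l : AggAtom) : Prop := ∃ r ∈ P.rules, l ∈ r.agg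

/-! ### Semantics -/

/-- The fixed interpretation of the aggregate function symbols: an integer for every
finite set and every finite multiset of constants. -/
abbrev AggInterp := ℕ → Finset Const ⊕ Multiset Const → ℤ

def PTerm.subst (a : Const) (η : ℕ → Const) : PTerm → Const
  | .const c => c
  | .grouped => a
  | .loc j => η j

/-- The instance of the defining atom for `X/a` and `Zⱼ/η j`. -/
def ISet.inst (s : ISet) (a : Const) (η : ℕ → Const) : Atom :=
  ⟨s.pred, s.args.map (PTerm.subst a η)⟩

/-- The local variables. -/
def ISet.locals (s : ISet) : Finset ℕ :=
  (s.args.filterMap fun | .loc j => some j | _ => none).toFinset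

open Classical in
/-- Value of an intensional set in the interpretation `I` over the Herbrand universe `H`. -/
noncomputable def ISet.setVal (s : ISet) (H : Finset Const) (I : Set Atom) : Finset Const :=
  H.filter fun a => s.inst a (fun _ => a) ∈ I

open Classical in
/-- Value of an intensional multiset: one occurrence of `a` for every substitution of the
local variables by constants which, together with `X/a`, makes the defining atom true.
(The value `a` given to numbers that are not local variables plays no role.) -/
noncomputable def ISet.multisetVal (s : ISet) (H : Finset Const) (I : Set Atom) :
    Multiset Const :=
  ((H ×ˢ Fintype.piFinset fun _ : {j // j ∈ s.locals} => H).filter fun γ =>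
    s.inst γ.1 (fun j => if h : j ∈ s.locals then γ.2 ⟨j, h⟩ else γ.1) ∈ I).val.map Prod.fst

noncomputable def ISet.val (s : ISet) (H : Finset Const) (I : Set Atom) :
    Finset Const ⊕ Multiset Const :=
  if s.multi then .inr (s.multisetVal H I) else .inl (s.setVal H I)

def RelOp.Holds : RelOp → ℤ → ℤ → Prop
  | .eq, a, b => a = b
  | .ne, a, b => a ≠ b
  | .lt, a, b => a < b
  | .gt, a, b => a > b
  | .le, a, b => a ≤ b
  | .ge, a, b => a ≥ b

/-- `I ⊨ ℓ` for an interpretation `I` of `P` and an aggregate atom `ℓ`. -/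
def Program.Sat (P : Program) (ι : AggInterp) (I : Set Atom) (l : AggAtom) : Prop :=
  l.op.Holds (ι l.fn (l.iset.val P.consts.toFinset I)) l.result

/-- `𝓗(ℓ)`: the atoms built from the grouped predicate of `ℓ` and the Herbrand universe. -/
def Program.aggBase (P : Program) (l : AggAtom) : Set Atom :=
  {a | a.pred = l.iset.pred ∧ a.args.length = l.iset.args.length ∧ ∀ c ∈ a.args, c ∈ P.consts}

/-- `⟨S₁, S₂⟩` is an aggregate solution of `ℓ`. -/
def Program.IsSolution (P : Program) (ι : AggInterp) (l : AggAtom) (S₁ S₂ : Set Atom) : Prop :=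
  S₁ ⊆ P.aggBase l ∧ S₂ ⊆ P.aggBase l ∧ Disjoint S₁ S₂ ∧
    ∀ I ⊆ P.base, S₁ ⊆ I → S₂ ∩ I = ∅ → P.Sat ι I l

/-- The reduct of `P` with respect to `M`. -/
def Program.reduct (P : Program) (M : Set Atom) : Set Rule :=
  {r' | ∃ r ∈ P.rules, (∀ b ∈ r.neg, b ∉ M) ∧ r' = { r with neg := [] }}

/-- Conditional satisfaction of an aggregate atom with respect to `I` and `M`. -/
def Program.CondSat (P : Program) (ι : AggInterp) (I M : Set Atom) (l : AggAtom) : Prop :=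
  P.IsSolution ι l (I ∩ M ∩ P.aggBase l) (P.aggBase l \ M)

/-- The consequence operator. -/
def Program.K (P : Program) (ι : AggInterp) (M I : Set Atom) : Set Atom :=
  {a | ∃ r ∈ P.reduct M, a = r.head ∧ (∀ b ∈ r.pos, b ∈ I) ∧ ∀ l ∈ r.agg, P.CondSat ι I M l}

/-- `M` is a fixpoint answer set: an interpretation which is the least fixpoint of the
consequence operator among the interpretations of `P`. -/
def Program.IsFixpointAnswerSet (P : Program) (ι : AggInterp) (M : Set Atom) : Prop :=
  IsLeast {I | I ⊆ P.base ∧ P.K ι M I = I} M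

/-! ### Coding of instances as trees -/

namespace Sexp

def ofList {α : Type} (f : α → Sexp) (l : List α) : Sexp := l.foldr (fun a t => cons (f a) t) nil

/-- Binary notation, least significant bit first. -/
def ofNat (n : ℕ) : Sexp := ofList ofBool n.bits

def ofInt (z : ℤ) : Sexp := cons (ofBool (decide (z < 0))) (ofNat z.natAbs)

def ofConst : Const → Sexp
  | .int z => cons (ofBool false) (ofInt z)
  | .sym n => cons (ofBool true) (ofNat n)

def ofAtom (a : Atom) : Sexp := cons (ofNat a.pred) (ofList ofConst a.args)

def ofPTerm : PTerm → Sexp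
  | .const c => cons (ofNat 0) (ofConst c)
  | .grouped => cons (ofNat 1) nil
  | .loc j => cons (ofNat 2) (ofNat j)

def ofISet (s : ISet) : Sexp := cons (ofBool s.multi) (cons (ofNat s.pred) (ofList ofPTerm s.args))

def ofRelOp : RelOp → Sexp
  | .eq => ofNat 0
  | .ne => ofNat 1
  | .lt => ofNat 2
  | .gt => ofNat 3
  | .le => ofNat 4
  | .ge => ofNat 5

def ofAggAtom (l : AggAtom) : Sexp :=
  cons (ofNat l.fn) (cons (ofISet l.iset) (cons (ofRelOp l.op) (ofInt l.result)))

def ofRule (r : Rule) : Sexp :=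
  cons (ofAtom r.head)
    (cons (ofList ofAggAtom r.agg) (cons (ofList ofAtom r.pos) (ofList ofAtom r.neg)))

def ofProgram (P : Program) : Sexp :=
  cons (ofList ofConst P.consts)
    (cons (ofList (fun p : ℕ × ℕ => cons (ofNat p.1) (ofNat p.2)) P.preds)
      (ofList ofRule P.rules))

/-- Instance "aggregate atom `ℓ`, interpretation given by the list `M` of its atoms". -/
def ofTruthQuery (l : AggAtom) (M : List Atom) : Sexp := cons (ofAggAtom l) (ofList ofAtom M)

end Sexp

/-! ### `C`-decidability -/

/-- The oracle `A` decides the truth value of the aggregate atom `ℓ` with respect to the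
interpretations `M` of `P`. -/
def Program.AggDecidedBy (P : Program) (ι : AggInterp) (A : Lang) (l : AggAtom) : Prop :=
  ∀ M : List Atom, {a | a ∈ M} ⊆ P.base →
    (Sexp.ofTruthQuery l M ∈ A ↔ P.Sat ι {a | a ∈ M} l)

/-- The programs in `𝒬` are `𝒞`-decidable: an oracle from the class `𝒞` decides the truth
values of the aggregate atoms occurring in them. (A single finite program has only finitely
many truth values; as complexity is about all instances, the oracle is one for all of `𝒬`.) -/
def ClassDecidable (ι : AggInterp) (𝒞 : Set Lang) (𝒬 : Set Program) : Prop :=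
  ∃ A ∈ 𝒞, ∀ P ∈ 𝒬, ∀ l, P.HasAgg l → P.AggDecidedBy ι A l

/-- A decision problem on a set `𝒬` of programs belongs to the class `𝒦` of languages:
some language in `𝒦` answers it correctly on the codes of all programs in `𝒬`. -/
def ProblemIn (𝒦 : Set Lang) (𝒬 : Set Program) (yes : Program → Prop) : Prop :=
  ∃ L ∈ 𝒦, ∀ P ∈ 𝒬, (Sexp.ofProgram P ∈ L ↔ yes P)

/-!
An answer set `M` is certified by a derivation: a list of rules in which every rule fires with
respect to `M` and the heads of the rules behind it, and whose heads form the set `M`. Such a list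
exists without repetitions, so its size is bounded by that of the program; conversely, the heads
of a derivation are contained in every set closed under the rules, so that closedness of its set
of heads is all that remains to be verified.

The only expensive part of the verification is conditional satisfaction: for `I ⊆ M` the pair
`⟨I ∩ M ∩ 𝓗(ℓ), 𝓗(ℓ) \ M⟩` is a solution of `ℓ` if and only if `J ⊨ ℓ` for all `J` between `I`
and `M`. All these quantifiers over `J` can be pulled out to a common one, in front of a
polynomial-time test which asks for the truth values of aggregate atoms in `J`. Hence a single
question to an oracle in `co-NP^𝒞` verifies a certificate.
-/

/-! ### Polynomial-time programs -/

theorem monotone_polynomial_eval {R : Type*} [Semiring R] [PartialOrder R] [IsOrderedRing R]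
    [CanonicallyOrderedAdd R] (p : Polynomial R) : Monotone fun x => p.eval x := by
  intro x y hxy
  simp only [Polynomial.eval_eq_sum]
  exact Finset.sum_le_sum fun i _ =>
    mul_le_mul_of_nonneg_left (pow_le_pow_left₀ zero_le hxy i) zero_le

namespace Sexp

@[simp] theorem hd_nil : nil.hd = nil := rfl

@[simp] theorem tl_nil : nil.tl = nil := rfl

@[simp] theorem hd_cons (a b : Sexp) : (cons a b).hd = a := rfl

@[simp] theorem tl_cons (a b : Sexp) : (cons a b).tl = b := rfl

@[simp] theorem size_nil : nil.size = 1 := rfl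

@[simp] theorem size_cons (a b : Sexp) : (cons a b).size = 1 + a.size + b.size := rfl

theorem size_pos (x : Sexp) : 0 < x.size := by
  cases x <;> simp only [size_nil, size_cons] <;> omega

theorem size_hd_le (x : Sexp) : x.hd.size ≤ x.size := by
  cases x <;> simp only [hd_nil, hd_cons, size_cons] <;> omega

theorem size_tl_le (x : Sexp) : x.tl.size ≤ x.size := by
  cases x <;> simp only [tl_nil, tl_cons, size_cons] <;> omega

theorem size_tl_lt {x : Sexp} (hx : x ≠ nil) : x.tl.size < x.size := by
  cases x with
  | nil => exact absurd rfl hx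
  | cons a b => simp only [tl_cons, size_cons]; omega

theorem size_ofBool_le (b : Bool) : (ofBool b).size ≤ 3 := by
  cases b <;> simp [ofBool]

@[simp] theorem ofBool_eq_nil_iff {b : Bool} : ofBool b = nil ↔ b = false := by
  cases b <;> simp [ofBool]

end Sexp

/-- Total correctness with a time bound: started in `s`, the program `c` halts within `T` steps
in a store with the property `Q`. -/
def RunsIn (O : Lang) (c : Cmd) (s : Store) (T : ℕ) (Q : Store → Prop) : Prop :=
  ∃ (t : ℕ) (s' : Store), Exec O c s t s' ∧ t ≤ T ∧ Q s'

namespace RunsIn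

variable {O : Lang} {c d : Cmd} {s : Store} {T T' : ℕ} {Q R : Store → Prop} {x : ℕ}

theorem mono (h : RunsIn O c s T Q) (hT : T ≤ T') (hQ : ∀ s', Q s' → R s') :
    RunsIn O c s T' R := by
  obtain ⟨t, s', e, ht, hs'⟩ := h
  exact ⟨t, s', e, ht.trans hT, hQ s' hs'⟩

theorem seq (hc : RunsIn O c s T Q) (hd : ∀ s', Q s' → RunsIn O d s' T' R) :
    RunsIn O (.seq c d) s (T + T') R := by
  obtain ⟨t, s', e, ht, hs'⟩ := hc
  obtain ⟨t', s'', e', ht', hs''⟩ := hd s' hs'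
  exact ⟨_, _, .seq e e', add_le_add ht ht', hs''⟩

theorem ite (hc : s x ≠ .nil → RunsIn O c s T Q) (hd : s x = .nil → RunsIn O d s T Q) :
    RunsIn O (.ite x c d) s (1 + T) Q := by
  by_cases hx : s x = .nil
  · obtain ⟨t, s', e, ht, hs'⟩ := hd hx
    exact ⟨_, _, .iteFalse hx e, by omega, hs'⟩
  · obtain ⟨t, s', e, ht, hs'⟩ := hc hx
    exact ⟨_, _, .iteTrue hx e, by omega, hs'⟩

theorem loop {Inv : Store → Prop} {μ : Store → ℕ}
    (hc : ∀ s, Inv s → s x ≠ .nil → RunsIn O c s T fun s' => Inv s' ∧ μ s' < μ s) {n : ℕ}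
    (hn : μ s ≤ n) (hs : Inv s) :
    RunsIn O (.loop x c) s (1 + n * (1 + T)) fun s' => Inv s' ∧ s' x = .nil := by
  induction n generalizing s with
  | zero =>
    have hx : s x = .nil := by
      by_contra hx
      obtain ⟨_, _, _, _, _, hlt⟩ := hc s hs hx
      omega
    exact ⟨1, s, .loopStop hx, by omega, hs, hx⟩
  | succ n ih =>
    by_cases hx : s x = .nil
    · exact ⟨1, s, .loopStop hx, by omega, hs, hx⟩
    · obtain ⟨t, s', e, ht, hs', hlt⟩ := hc s hs hx
      obtain ⟨t', s'', e', ht', hs''⟩ := ih (by omega) hs'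
      exact ⟨_, s'', .loopStep hx e e', by rw [add_one_mul]; omega, hs''⟩

end RunsIn

/-- `f` is computable in polynomial time with oracle `O`. For all choices of an input register
`i` and an output register `j` below some `m` there has to be a program which leaves the other
registers below `m` unchanged, so that programs can be composed without sharing scratch
registers. -/
def PolyTime (O : Lang) (f : Sexp → Sexp) : Prop :=
  ∃ p : Polynomial ℕ, ∀ m i j, i < m → j < m → ∃ c : Cmd, ∀ s : Store,
    RunsIn O c s (p.eval (s i).size) fun s' =>
      ∀ k < m, s' k = Function.update s j (f (s i)) k

open Classical in
/-- The predicate `S` is decidable in polynomial time with oracle `O`. -/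
def PolyDec (O : Lang) (S : Sexp → Prop) : Prop :=
  PolyTime O fun x => .ofBool (decide (S x))

open Classical in
/-- The slack `+ 1` is needed for a query answered positively, which writes a tree of size three
and may cost only two steps. -/
theorem Exec.size_le {O : Lang} {c : Cmd} {s s' : Store} {t : ℕ} (h : Exec O c s t s') (k : ℕ) :
    s' k = s k ∨ (s' k).size ≤ t + 1 := by
  induction h with
  | query x y s =>
    have := (s y).size_pos
    have := Sexp.size_ofBool_le (decide (s y ∈ O))
    grind [Function.update_apply]
  | _ => grind [Function.update_apply, Sexp.size_nil]

namespace PolyTime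

variable {O : Lang} {S : Sexp → Prop} {f g : Sexp → Sexp}

theorem exists_size_le (hf : PolyTime O f) :
    ∃ q : Polynomial ℕ, ∀ x, (f x).size ≤ q.eval x.size := by
  obtain ⟨p, hp⟩ := hf
  obtain ⟨c, hc⟩ := hp 2 0 1 two_pos one_lt_two
  refine ⟨p + 1, fun x => ?_⟩
  obtain ⟨t, s', e, ht, hs'⟩ := hc (initStore x)
  have hout : s' 1 = f x := by simpa [initStore] using hs' 1 one_lt_two
  have htime : t ≤ p.eval x.size := by simpa [initStore] using ht
  have := (f x).size_pos
  rcases e.size_le 1 with h | h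
  · rw [hout] at h
    simp [h, initStore]
  · rw [hout] at h
    rw [Polynomial.eval_add, Polynomial.eval_one]
    omega

theorem of_exec {cmd : ℕ → ℕ → Cmd} (p : Polynomial ℕ)
    (h : ∀ i j s, ∃ t ≤ p.eval (s i).size,
      Exec O (cmd i j) s t (Function.update s j (f (s i)))) : PolyTime O f := by
  refine ⟨p, fun m i j _ _ => ⟨cmd i j, fun s => ?_⟩⟩
  obtain ⟨t, ht, e⟩ := h i j s
  exact ⟨t, _, e, ht, fun _ _ => rfl⟩

theorem congr (hf : PolyTime O f) (h : ∀ x, f x = g x) : PolyTime O g :=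
  funext h ▸ hf

theorem id : PolyTime O fun x => x :=
  of_exec (1 + .X) fun i j s => ⟨_, by simp, .copy j i s⟩

theorem const_nil : PolyTime O fun _ => .nil :=
  of_exec 1 fun _ j s => ⟨_, by simp, .setNil j s⟩

theorem comp (hg : PolyTime O g) (hf : PolyTime O f) : PolyTime O fun x => g (f x) := by
  obtain ⟨q, hq⟩ := hf.exists_size_le
  obtain ⟨p, hf⟩ := hf
  obtain ⟨p', hg⟩ := hg
  refine ⟨p + p'.comp q, fun m i j hi hj => ?_⟩
  obtain ⟨c, hc⟩ := hf (m + 1) i m (by omega) (by omega)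
  obtain ⟨d, hd⟩ := hg (m + 1) m j (by omega) (by omega)
  refine ⟨.seq c d, fun s => ?_⟩
  rw [Polynomial.eval_add, Polynomial.eval_comp]
  refine (hc s).seq fun s₁ h₁ => (hd s₁).mono ?_ fun s₂ h₂ => ?_
  · rw [show s₁ m = f (s i) by simpa using h₁ m (by omega)]
    exact monotone_polynomial_eval p' (hq _)
  · grind [Function.update_apply]

theorem hd (hf : PolyTime O f) : PolyTime O fun x => (f x).hd :=
  comp (g := Sexp.hd) (of_exec (1 + .X) fun i j s =>
    ⟨_, by simpa using (s i).size_hd_le, .hd j i s⟩) hf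

theorem tl (hf : PolyTime O f) : PolyTime O fun x => (f x).tl :=
  comp (g := Sexp.tl) (of_exec (1 + .X) fun i j s =>
    ⟨_, by simpa using (s i).size_tl_le, .tl j i s⟩) hf

theorem cons (hf : PolyTime O f) (hg : PolyTime O g) :
    PolyTime O fun x => .cons (f x) (g x) := by
  obtain ⟨q, hq⟩ := hf.exists_size_le
  obtain ⟨q', hq'⟩ := hg.exists_size_le
  obtain ⟨p, hf⟩ := hf
  obtain ⟨p', hg⟩ := hg
  refine ⟨p + (p' + (2 + q + q')), fun m i j hi hj => ?_⟩
  obtain ⟨c, hc⟩ := hf (m + 1) i m (by omega) (by omega)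
  obtain ⟨d, hd⟩ := hg (m + 2) i (m + 1) (by omega) (by omega)
  refine ⟨.seq c (.seq d (.cons j m (m + 1))), fun s => ?_⟩
  simp only [Polynomial.eval_add, Polynomial.eval_ofNat]
  refine (hc s).seq fun s₁ h₁ => ?_
  have hi₁ : s₁ i = s i := by grind [Function.update_apply]
  rw [← hi₁]
  refine (hd s₁).seq fun s₂ h₂ => ⟨_, _, .cons j m (m + 1) s₂, ?_, ?_⟩
  · have hm : s₂ m = f (s i) := by grind [Function.update_apply]
    have hm' : s₂ (m + 1) = g (s i) := by grind [Function.update_apply]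
    have := hq (s i)
    have := hq' (s i)
    rw [hm, hm', hi₁, Sexp.size_cons]
    omega
  · grind [Function.update_apply]

theorem ofBool (b : Bool) : PolyTime O fun _ => .ofBool b := by
  cases b
  · exact const_nil
  · exact cons const_nil const_nil

open Classical in
theorem ite (hS : PolyDec O S) (hf : PolyTime O f) (hg : PolyTime O g) :
    PolyTime O fun x => if S x then f x else g x := by
  obtain ⟨p, hS⟩ := hS
  obtain ⟨q, hf⟩ := hf
  obtain ⟨r, hg⟩ := hg
  refine ⟨p + (1 + (q + r)), fun m i j hi hj => ?_⟩
  obtain ⟨test, htest⟩ := hS (m + 1) i m (by omega) (by omega)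
  obtain ⟨c, hc⟩ := hf m i j hi hj
  obtain ⟨d, hd⟩ := hg m i j hi hj
  refine ⟨.seq test (.ite m c d), fun s => ?_⟩
  simp only [Polynomial.eval_add, Polynomial.eval_one]
  refine (htest s).seq fun s₁ h₁ => ?_
  have hi₁ : s₁ i = s i := by grind [Function.update_apply]
  have hm : s₁ m = .ofBool (decide (S (s i))) := by simpa using h₁ m (by omega)
  have hS_iff : s₁ m = .nil ↔ ¬ S (s i) := by simp [hm]
  rw [← hi₁]
  refine RunsIn.ite (fun hne => (hc s₁).mono (by omega) ?_)
    fun heq => (hd s₁).mono (by omega) ?_ <;> grind [Function.update_apply]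

theorem exists_inPlace (hf : PolyTime O f) : ∃ p : Polynomial ℕ, ∀ m, ∃ c : Cmd, ∀ s : Store,
    RunsIn O c s (p.eval (s m).size) fun s' => s' m = f (s m) ∧ ∀ k < m, s' k = s k := by
  obtain ⟨p, hf⟩ := hf
  refine ⟨p, fun m => ?_⟩
  obtain ⟨c, hc⟩ := hf (m + 1) m m (by omega) (by omega)
  refine ⟨c, fun s => (hc s).mono le_rfl fun s' hs' => ⟨?_, fun k hk => ?_⟩⟩
  · rw [hs' m (by omega), Function.update_self]
  · rw [hs' k (by omega), Function.update_of_ne hk.ne]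

theorem exists_test (hS : PolyDec O S) : ∃ p : Polynomial ℕ, ∀ m, ∃ c : Cmd, ∀ s : Store,
    RunsIn O c s (p.eval (s m).size) fun s' =>
      s' m = s m ∧ (s' (m + 1) = .nil ↔ ¬ S (s m)) ∧ ∀ k < m, s' k = s k := by
  obtain ⟨p, hS⟩ := hS
  refine ⟨p, fun m => ?_⟩
  obtain ⟨c, hc⟩ := hS (m + 2) m (m + 1) (by omega) (by omega)
  refine ⟨c, fun s => (hc s).mono le_rfl fun s' hs' => ⟨?_, ?_, fun k hk => ?_⟩⟩
  · rw [hs' m (by omega), Function.update_of_ne (by omega)]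
  · simp [hs' (m + 1) (by omega)]
  · rw [hs' k (by omega), Function.update_of_ne (by omega)]

theorem exists_while {β : Type*} {F : Sexp → β} {μ : Sexp → ℕ} (q : Polynomial ℕ)
    (hS : PolyDec O S) (hf : PolyTime O f) (hμ : ∀ z, μ z ≤ q.eval z.size)
    (hsize : ∀ z, S z → (f z).size ≤ z.size) (hlt : ∀ z, S z → μ (f z) < μ z)
    (hF : ∀ z, S z → F (f z) = F z) :
    ∃ p : Polynomial ℕ, ∀ m, ∃ c : Cmd, ∀ s : Store, RunsIn O c s (p.eval (s m).size) fun s' =>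
      ¬ S (s' m) ∧ F (s' m) = F (s m) ∧ (s' m).size ≤ (s m).size ∧ ∀ k < m, s' k = s k := by
  obtain ⟨p, htest⟩ := exists_test hS
  obtain ⟨p', hbody⟩ := exists_inPlace hf
  refine ⟨p + (1 + q * (1 + (p' + p))), fun m => ?_⟩
  obtain ⟨test, htest⟩ := htest m
  obtain ⟨body, hbody⟩ := hbody m
  refine ⟨.seq test (.loop (m + 1) (.seq body test)), fun s => ?_⟩
  simp only [Polynomial.eval_add, Polynomial.eval_mul, Polynomial.eval_one]
  let Inv : Store → Prop := fun s' => (s' (m + 1) = .nil ↔ ¬ S (s' m)) ∧ F (s' m) = F (s m) ∧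
    (s' m).size ≤ (s m).size ∧ ∀ k < m, s' k = s k
  have hstep : ∀ s₁, Inv s₁ → s₁ (m + 1) ≠ .nil → RunsIn O (.seq body test) s₁
      (p'.eval (s m).size + p.eval (s m).size) fun s₂ => Inv s₂ ∧ μ (s₂ m) < μ (s₁ m) := by
    rintro s₁ ⟨hiff₁, hF₁, hsize₁, hk₁⟩ hne
    have hSm : S (s₁ m) := by simpa using mt hiff₁.mpr hne
    have hsize₂ := (hsize _ hSm).trans hsize₁
    refine ((hbody s₁).mono (monotone_polynomial_eval p' hsize₁) fun _ h => h).seq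
      fun s₂ ⟨hm₂, hk₂⟩ => (htest s₂).mono (monotone_polynomial_eval p (hm₂ ▸ hsize₂))
      fun s₃ ⟨hm₃, hiff₃, hk₃⟩ => ?_
    rw [← hm₃] at hiff₃
    rw [hm₂] at hm₃
    refine ⟨⟨hiff₃, ?_, hm₃ ▸ hsize₂, fun k hk => ?_⟩, hm₃ ▸ hlt _ hSm⟩
    · rw [hm₃, hF _ hSm, hF₁]
    · rw [hk₃ k hk, hk₂ k hk, hk₁ k hk]
  refine (htest s).seq fun s₁ ⟨hm₁, hiff₁, hk₁⟩ => ?_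
  exact (RunsIn.loop hstep (hm₁ ▸ hμ _)
    ⟨hm₁ ▸ hiff₁, by rw [hm₁], by rw [hm₁], hk₁⟩).mono le_rfl
    fun s₂ ⟨⟨hiff₂, h₂⟩, hnil⟩ => ⟨hiff₂.mp hnil, h₂⟩

theorem of_tailRec {out F : Sexp → Sexp} {μ : Sexp → ℕ} (q : Polynomial ℕ) (hS : PolyDec O S)
    (hf : PolyTime O f) (hout : PolyTime O out) (hμ : ∀ z, μ z ≤ q.eval z.size)
    (hsize : ∀ z, S z → (f z).size ≤ z.size) (hlt : ∀ z, S z → μ (f z) < μ z)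
    (hcont : ∀ z, S z → F (f z) = F z) (hexit : ∀ z, ¬ S z → F z = out z) : PolyTime O F := by
  obtain ⟨p, hloop⟩ := exists_while q hS hf hμ hsize hlt hcont
  obtain ⟨r, hout⟩ := hout
  refine ⟨1 + .X + (p + r), fun m i j _ hj => ?_⟩
  obtain ⟨c, hc⟩ := hloop m
  obtain ⟨d, hd⟩ := hout (m + 1) m j (by omega) (by omega)
  refine ⟨.seq (.copy m i) (.seq c d), fun s => ?_⟩
  simp only [Polynomial.eval_add, Polynomial.eval_one, Polynomial.eval_X]
  refine RunsIn.seq (Q := fun s' => s' = Function.update s m (s i))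
    ⟨_, _, .copy m i s, le_rfl, rfl⟩ ?_
  rintro s₁ hs₁
  have hm : s₁ m = s i := by simp [hs₁]
  rw [← hm]
  refine (hc s₁).seq fun s₂ ⟨hnot, hFs, hsz, hk⟩ =>
    (hd s₂).mono (monotone_polynomial_eval r hsz) fun s₃ h₃ => ?_
  have hF₂ : out (s₂ m) = F (s₁ m) := by rw [← hexit _ hnot, hFs]
  intro k hkm
  rw [h₃ k (by omega), hF₂]
  by_cases hkj : k = j
  · simp [hkj]
  · rw [Function.update_of_ne hkj, Function.update_of_ne hkj, hk k hkm, hs₁,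
      Function.update_of_ne hkm.ne]

end PolyTime

/-! ### Polynomial-time predicates -/

namespace Sexp

variable {p : Sexp → Prop}

/-- The members of a tree read as a list. -/
def toList : Sexp → List Sexp
  | nil => []
  | cons a b => a :: b.toList

/-- Some nonempty final segment of the list `x` has the property `p`. -/
def ExTail (p : Sexp → Prop) : Sexp → Prop
  | nil => False
  | cons a b => p (cons a b) ∨ b.ExTail p

/-- All nonempty final segments of the list `x` have the property `p`. -/
def AllTail (p : Sexp → Prop) : Sexp → Prop
  | nil => True
  | cons a b => p (cons a b) ∧ b.AllTail p

theorem exTail_hd_iff (x : Sexp) : (x.ExTail fun t => p t.hd) ↔ ∃ a ∈ x.toList, p a := by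
  induction x with
  | nil => simp [ExTail, toList]
  | cons a b _ ih => simp [ExTail, toList, ih]

theorem not_exTail_not_iff (x : Sexp) : ¬ (x.ExTail fun t => ¬ p t) ↔ x.AllTail p := by
  induction x with
  | nil => simp [ExTail, AllTail]
  | cons a b _ ih => simp [ExTail, AllTail, ← ih]

/-- Total size of the members of a list; it bounds the number of times a tree can be
`unnest`ed. -/
def weight : Sexp → ℕ
  | nil => 0
  | cons a b => a.size + b.weight

theorem weight_le_size (x : Sexp) : x.weight ≤ x.size := by
  induction x with
  | nil => simp [weight]
  | cons a b _ ih => simp only [weight, size_cons]; omega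

/-- One step of the depth-first traversal of a tree whose unvisited subtrees are kept in a
list: an empty first member is dropped, any other one is replaced by its two components. -/
def unnest : Sexp → Sexp
  | nil => nil
  | cons nil r => r
  | cons (cons a b) r => cons a (cons b r)

theorem unnest_eq_ite [DecidablePred fun x : Sexp => x = nil] (x : Sexp) :
    x.unnest = if x.hd = nil then x.tl else cons x.hd.hd (cons x.hd.tl x.tl) := by
  rcases x with _ | ⟨_ | ⟨a, b⟩, r⟩ <;> simp [unnest]

theorem size_unnest_le (x : Sexp) : x.unnest.size ≤ x.size := by
  rcases x with _ | ⟨_ | ⟨a, b⟩, r⟩ <;> simp only [unnest, size_cons, size_nil] <;> omega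

theorem weight_unnest_lt {x : Sexp} (hx : x ≠ nil) : x.unnest.weight < x.weight := by
  rcases x with _ | ⟨_ | ⟨a, b⟩, r⟩
  · exact absurd rfl hx
  all_goals simp only [unnest, weight, size_cons, size_nil]; omega

theorem unnest_eq_unnest_iff {x y : Sexp} (hx : x ≠ nil) (hy : y ≠ nil)
    (h : x.hd = nil ↔ y.hd = nil) : x.unnest = y.unnest ↔ x = y := by
  rcases x with _ | ⟨_ | ⟨a, b⟩, r⟩ <;> rcases y with _ | ⟨_ | ⟨c, d⟩, s⟩ <;>
    simp_all [unnest, and_assoc]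

end Sexp

namespace PolyDec

variable {O : Lang} {S T : Sexp → Prop} {f g : Sexp → Sexp}

theorem comp (hS : PolyDec O S) (hf : PolyTime O f) : PolyDec O fun x => S (f x) :=
  PolyTime.comp hS hf

theorem congr (hS : PolyDec O S) (h : ∀ x, S x ↔ T x) : PolyDec O T := by
  rwa [← show S = T from funext fun x => propext (h x)]

open Classical in
theorem not (hS : PolyDec O S) : PolyDec O fun x => ¬ S x :=
  (PolyTime.ite hS (.ofBool false) (.ofBool true)).congr fun x => by
    by_cases h : S x <;> simp [h]

open Classical in
theorem and (hS : PolyDec O S) (hT : PolyDec O T) : PolyDec O fun x => S x ∧ T x :=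
  (PolyTime.ite hS hT (.ofBool false)).congr fun x => by
    by_cases h : S x <;> simp [h]

theorem or (hS : PolyDec O S) (hT : PolyDec O T) : PolyDec O fun x => S x ∨ T x :=
  (hS.not.and hT.not).not.congr fun x => by tauto

theorem imp (hS : PolyDec O S) (hT : PolyDec O T) : PolyDec O fun x => S x → T x :=
  (hS.not.or hT).congr fun x => by tauto

theorem iff (hS : PolyDec O S) (hT : PolyDec O T) : PolyDec O fun x => (S x ↔ T x) :=
  ((hS.imp hT).and (hT.imp hS)).congr fun x => by tauto

theorem query (hf : PolyTime O f) : PolyDec O fun x => f x ∈ O :=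
  comp (S := fun x => x ∈ O)
    (PolyTime.of_exec (1 + .X) fun i j s => ⟨_, by simp, .query j i s⟩) hf

theorem eq_nil (hf : PolyTime O f) : PolyDec O fun x => f x = .nil := by
  refine comp (S := fun x => x = .nil) (PolyTime.of_exec 6
    (cmd := fun i j => .ite i (.setNil j) (.seq (.setNil j) (.cons j j j))) fun i j s => ?_) hf
  by_cases h : s i = .nil
  · have hcons := Exec.cons (O := O) j j j (Function.update s j .nil)
    rw [Function.update_idem, Function.update_self] at hcons
    refine ⟨_, ?_, .iteFalse h (.seq (.setNil j s) (?_ : Exec _ _ _ 4 _))⟩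
    · simp
    · simpa [h, Sexp.ofBool] using hcons
  · refine ⟨_, ?_, .iteTrue h (?_ : Exec _ _ _ 1 _)⟩
    · simp
    · simpa [h, Sexp.ofBool] using Exec.setNil j s

theorem of_tailRec {P : Sexp → Prop} {μ : Sexp → ℕ} (q : Polynomial ℕ) (hS : PolyDec O S)
    (hf : PolyTime O f) (hT : PolyDec O T) (hμ : ∀ z, μ z ≤ q.eval z.size)
    (hsize : ∀ z, S z → (f z).size ≤ z.size) (hlt : ∀ z, S z → μ (f z) < μ z)
    (hcont : ∀ z, S z → (P (f z) ↔ P z)) (hexit : ∀ z, ¬ S z → (P z ↔ T z)) : PolyDec O P :=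
  PolyTime.of_tailRec q hS hf hT hμ hsize hlt
    (fun z hz => congrArg _ (decide_eq_decide.mpr (hcont z hz)))
    fun z hz => congrArg _ (decide_eq_decide.mpr (hexit z hz))

theorem exTail {p : Sexp → Sexp → Prop} (hf : PolyTime O f)
    (hp : PolyDec O fun z => p z.hd z.tl) : PolyDec O fun x => (f x).ExTail fun t => p t x := by
  suffices h : PolyDec O fun z => z.hd.ExTail fun t => p t z.tl from h.comp (.cons hf .id)
  have ne_nil : PolyDec O fun z => z.hd ≠ .nil := (eq_nil (.hd .id)).not
  refine of_tailRec (μ := fun z => z.hd.size) .X (ne_nil.and hp.not)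
    (.cons (.tl (.hd .id)) (.tl .id)) ne_nil (fun z => ?_) ?_ (fun z hz => ?_) ?_ ?_
  · simpa using z.size_hd_le
  · rintro (_ | ⟨l, x⟩) ⟨hne, -⟩
    · exact absurd rfl hne
    · simpa using l.size_tl_le
  · exact Sexp.size_tl_lt hz.1
  · rintro (_ | ⟨_ | ⟨a, l⟩, x⟩) ⟨hne, hp⟩
    · exact absurd rfl hne
    · exact absurd rfl hne
    · exact (or_iff_right hp).symm
  · rintro (_ | ⟨_ | ⟨a, l⟩, x⟩) hz
    · simp [Sexp.ExTail]
    · simp [Sexp.ExTail]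
    · simp_all [Sexp.ExTail]

theorem allTail {p : Sexp → Sexp → Prop} (hf : PolyTime O f)
    (hp : PolyDec O fun z => p z.hd z.tl) : PolyDec O fun x => (f x).AllTail fun t => p t x :=
  (exTail (p := fun t x => ¬ p t x) hf hp.not).not.congr fun x => (f x).not_exTail_not_iff

theorem exists_mem {p : Sexp → Sexp → Prop} (hf : PolyTime O f)
    (hp : PolyDec O fun z => p z.hd z.tl) : PolyDec O fun x => ∃ a ∈ (f x).toList, p a x :=
  (exTail (p := fun t x => p t.hd x) hf (hp.comp (.cons (.hd (.hd .id)) (.tl .id)))).congr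
    fun x => (f x).exTail_hd_iff (p := fun t => p t x)

theorem forall_mem {p : Sexp → Sexp → Prop} (hf : PolyTime O f)
    (hp : PolyDec O fun z => p z.hd z.tl) : PolyDec O fun x => ∀ a ∈ (f x).toList, p a x :=
  (exists_mem (p := fun t x => ¬ p t x) hf hp.not).not.congr fun x => by push Not; rfl

theorem eq (hf : PolyTime O f) (hg : PolyTime O g) : PolyDec O fun x => f x = g x := by
  classical
  suffices h : PolyDec O fun z => z.hd = z.tl from h.comp (.cons hf hg)
  have unnest {e : Sexp → Sexp} (he : PolyTime O e) : PolyTime O fun z => (e z).unnest := by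
    simp only [Sexp.unnest_eq_ite]
    exact PolyTime.ite (eq_nil he.hd) he.tl (he.hd.hd.cons (he.hd.tl.cons he.tl))
  have nil_hd : PolyDec O fun z => z.hd = .nil := eq_nil (.hd .id)
  have nil_tl : PolyDec O fun z => z.tl = .nil := eq_nil (.tl .id)
  refine of_tailRec (μ := fun z => z.hd.weight)
    (S := fun z => z.hd ≠ .nil ∧ z.tl ≠ .nil ∧ (z.hd.hd = .nil ↔ z.tl.hd = .nil)) .X
    (nil_hd.not.and (nil_tl.not.and ((eq_nil (.hd (.hd .id))).iff (eq_nil (.hd (.tl .id))))))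
    ((unnest (.hd .id)).cons (unnest (.tl .id))) (nil_hd.and nil_tl)
    (fun z => ?_) ?_ (fun z hz => ?_) (fun z hz => ?_) fun z hz => ?_
  · simpa using z.hd.weight_le_size.trans z.size_hd_le
  · rintro (_ | ⟨x, y⟩) ⟨hne, -⟩
    · exact absurd rfl hne
    · have := x.size_unnest_le
      have := y.size_unnest_le
      simp only [Sexp.size_cons, Sexp.hd_cons, Sexp.tl_cons]
      omega
  · exact Sexp.weight_unnest_lt hz.1
  · exact Sexp.unnest_eq_unnest_iff hz.1 hz.2.1 hz.2.2
  · grind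

theorem mem_toList (hf : PolyTime O f) (hg : PolyTime O g) :
    PolyDec O fun x => f x ∈ (g x).toList :=
  (exists_mem (p := fun a x => a = f x) hg (.eq (.hd .id) (hf.comp (.tl .id)))).congr
    fun _ => exists_eq_right

theorem mem_PWith (hS : PolyDec O S) : {x | S x} ∈ PWith O := by
  obtain ⟨p, hp⟩ := hS
  obtain ⟨c, hc⟩ := hp 1 0 0 one_pos one_pos
  refine ⟨c, p, fun x => ?_⟩
  obtain ⟨t, s, e, ht, hs⟩ := hc (initStore x)
  have h0 : initStore x 0 = x := Function.update_self ..
  rw [h0] at ht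
  exact ⟨t, s, e, ht, by simp [hs 0 one_pos, h0]⟩

end PolyDec

theorem mem_NPRel_coNPRel {A : Lang} {𝒞 : Set Lang} {G : Sexp → Sexp → Sexp → Prop}
    (hA : A ∈ 𝒞) (hG : PolyDec A fun z => G z.hd.hd z.hd.tl z.tl) (q r : Polynomial ℕ) :
    {x | ∃ w : Sexp, w.size ≤ q.eval x.size ∧
      ∀ u : Sexp, u.size ≤ r.eval (Sexp.cons x w).size → G x w u} ∈ NPRel (coNPRel 𝒞) := by
  refine ⟨{y | ∀ u : Sexp, u.size ≤ r.eval y.size → G y.hd y.tl u},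
    ⟨A, hA, _, hG.not.mem_PWith, r, fun y => ?_⟩, _, (PolyDec.query .id).mem_PWith, q,
    fun x => Iff.rfl⟩
  simp

/-! ### Derivations and answer sets -/

namespace Program

variable {P : Program} {ι : AggInterp} {l : AggAtom} {I J M : Set Atom} {r : Rule}
  {rs ts : List Rule}

theorem inst_mem_aggBase {η : ℕ → Const} {a : Const} (hl : l.Over P.preds P.consts)
    (ha : a ∈ P.consts) (hη : ∀ j, PTerm.loc j ∈ l.iset.args → η j ∈ P.consts) :
    l.iset.inst a η ∈ P.aggBase l := by
  refine ⟨rfl, by simp [ISet.inst], fun c hc => ?_⟩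
  obtain ⟨t, ht, rfl⟩ := List.mem_map.mp hc
  cases t with
  | const c => exact hl.1.2.2.2 c ht
  | grouped => exact ha
  | loc j => exact hη j ht

theorem setVal_congr (hl : l.Over P.preds P.consts) (hset : l.iset.multi = false)
    (h : ∀ a ∈ P.aggBase l, a ∈ I ↔ a ∈ J) :
    l.iset.setVal P.consts.toFinset I = l.iset.setVal P.consts.toFinset J := by
  classical
  exact Finset.filter_congr fun a ha => h _ <| inst_mem_aggBase hl (by simpa using ha)
    fun j hj => absurd hj (hl.1.2.2.1 hset j)

theorem multisetVal_congr (hl : l.Over P.preds P.consts)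
    (h : ∀ a ∈ P.aggBase l, a ∈ I ↔ a ∈ J) :
    l.iset.multisetVal P.consts.toFinset I = l.iset.multisetVal P.consts.toFinset J := by
  classical
  refine congrArg (fun s : Finset _ => s.val.map Prod.fst) (Finset.filter_congr fun γ hγ => ?_)
  rw [Finset.mem_product, Fintype.mem_piFinset] at hγ
  refine h _ (inst_mem_aggBase hl (by simpa using hγ.1) fun j hj => ?_)
  have hj' : j ∈ l.iset.locals := List.mem_toFinset.mpr (List.mem_filterMap.mpr ⟨_, hj, rfl⟩)
  simpa [hj'] using hγ.2 ⟨j, hj'⟩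

theorem sat_congr (hl : l.Over P.preds P.consts) (h : ∀ a ∈ P.aggBase l, a ∈ I ↔ a ∈ J) :
    P.Sat ι I l ↔ P.Sat ι J l := by
  have hval : l.iset.val P.consts.toFinset I = l.iset.val P.consts.toFinset J := by
    unfold ISet.val
    split_ifs with hmulti
    · rw [multisetVal_congr hl h]
    · rw [setVal_congr hl (by simpa using hmulti) h]
  rw [Sat, Sat, hval]

theorem CondSat.mono (hIJ : I ⊆ J) (h : P.CondSat ι I M l) : P.CondSat ι J M l := by
  refine ⟨Set.inter_subset_right, h.2.1, ?_, fun K hK hJK hMK => h.2.2.2 K hK ?_ hMK⟩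
  · exact Set.disjoint_left.mpr fun a ha ha' => ha'.2 ha.1.2
  · exact fun a ha => hJK ⟨⟨hIJ ha.1.1, ha.1.2⟩, ha.2⟩

theorem condSat_iff (hl : l.Over P.preds P.consts) (hIM : I ⊆ M) (hM : M ⊆ P.base) :
    P.CondSat ι I M l ↔ ∀ J, I ⊆ J → J ⊆ M → P.Sat ι J l := by
  constructor
  · rintro ⟨-, -, -, h⟩ J hIJ hJM
    refine h J (hJM.trans hM) (fun a ha => hIJ ha.1.1) ?_
    exact Set.eq_empty_of_forall_notMem fun a ha => ha.1.2 (hJM ha.2)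
  · intro h
    refine ⟨Set.inter_subset_right, Set.sdiff_subset,
      Set.disjoint_left.mpr fun a ha ha' => ha'.2 ha.1.2, fun J _ hIJ hMJ => ?_⟩
    -- Only the atoms of `𝓗(ℓ)` matter, and there `J` agrees with a set between `I` and `M`.
    have hJM : J ∩ P.aggBase l ∪ I ⊆ M := by
      refine Set.union_subset (fun a ha => ?_) hIM
      by_contra haM
      exact (Set.eq_empty_iff_forall_notMem.mp hMJ) a ⟨⟨ha.2, haM⟩, ha.1⟩
    refine (sat_congr hl fun a ha => ⟨?_, fun haJ => .inl ⟨haJ, ha⟩⟩).mp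
      (h _ Set.subset_union_right hJM)
    exact Or.rec And.left fun haI => hIJ ⟨⟨haI, hIM haI⟩, ha⟩

/-- The head of the rule `r` of `P` is derived in one step from `I` by the consequence operator
for `M`. -/
def Fires (P : Program) (ι : AggInterp) (M I : Set Atom) (r : Rule) : Prop :=
  (∀ b ∈ r.neg, b ∉ M) ∧ (∀ b ∈ r.pos, b ∈ I) ∧ ∀ l ∈ r.agg, P.CondSat ι I M l

theorem Fires.mono (hIJ : I ⊆ J) (h : P.Fires ι M I r) : P.Fires ι M J r :=
  ⟨h.1, fun b hb => hIJ (h.2.1 b hb), fun l hl => (h.2.2 l hl).mono hIJ⟩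

theorem mem_K_iff {a : Atom} :
    a ∈ P.K ι M I ↔ ∃ r ∈ P.rules, r.head = a ∧ P.Fires ι M I r := by
  constructor
  · rintro ⟨_, ⟨r, hr, hneg, rfl⟩, rfl, hpos, hagg⟩
    exact ⟨r, hr, rfl, hneg, hpos, hagg⟩
  · rintro ⟨r, hr, rfl, hneg, hpos, hagg⟩
    exact ⟨_, ⟨r, hr, hneg, rfl⟩, rfl, hpos, hagg⟩

/-- The condition of `Fires` with the aggregate atoms evaluated in the single interpretation
`J`, so that it can be tested with an oracle for their truth values. -/
def BodyHolds (P : Program) (ι : AggInterp) (M I J : Set Atom) (r : Rule) : Prop :=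
  (∀ b ∈ r.neg, b ∉ M) ∧ (∀ b ∈ r.pos, b ∈ I) ∧ ∀ l ∈ r.agg, P.Sat ι J l

theorem fires_iff (hr : r ∈ P.rules) (hIM : I ⊆ M) (hM : M ⊆ P.base) :
    P.Fires ι M I r ↔ ∀ J, I ⊆ J → J ⊆ M → P.BodyHolds ι M I J r := by
  have hagg (l : AggAtom) (hl : l ∈ r.agg) :=
    condSat_iff (ι := ι) ((P.rules_over r hr).2.1 l hl) hIM hM
  constructor
  · exact fun h J hIJ hJM => ⟨h.1, h.2.1, fun l hl => (hagg l hl).mp (h.2.2 l hl) J hIJ hJM⟩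
  · intro h
    have hbody := h M hIM subset_rfl
    exact ⟨hbody.1, hbody.2.1, fun l hl => (hagg l hl).mpr fun J hIJ hJM =>
      (h J hIJ hJM).2.2 l hl⟩

theorem fires_self_iff (hr : r ∈ P.rules) (hM : M ⊆ P.base) :
    P.Fires ι M M r ↔ P.BodyHolds ι M M M r :=
  (fires_iff hr subset_rfl hM).trans
    ⟨fun h => h M subset_rfl subset_rfl, fun h _ hMJ hJM => hMJ.antisymm hJM ▸ h⟩

/-- The set of the heads of the rules in a list. -/
def heads (rs : List Rule) : Set Atom := {a | ∃ r ∈ rs, r.head = a}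

theorem heads_cons : heads (r :: rs) = insert r.head (heads rs) := by
  ext a
  simp [heads, eq_comm]

theorem heads_mono (h : ts ⊆ rs) : heads ts ⊆ heads rs := fun _ ⟨r, hr, ha⟩ => ⟨r, h hr, ha⟩

theorem heads_subset_base (h : ∀ r ∈ rs, r ∈ P.rules) : heads rs ⊆ P.base := by
  rintro _ ⟨r, hr, rfl⟩
  exact (P.rules_over r (h r hr)).1

/-- A list of rules of `P` in which every rule fires with respect to `M` and the heads of the
rules behind it: the conclusions are derived from the end of the list to its beginning. -/
def Derivation (P : Program) (ι : AggInterp) (M : Set Atom) (rs : List Rule) : Prop :=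
  ∀ r ts, r :: ts <:+ rs → r ∈ P.rules ∧ P.Fires ι M (heads ts) r

theorem derivation_cons_iff : P.Derivation ι M (r :: rs) ↔
    (r ∈ P.rules ∧ P.Fires ι M (heads rs) r) ∧ P.Derivation ι M rs := by
  simp only [Derivation, List.suffix_cons_iff, List.cons.injEq, or_imp, and_imp, forall_and,
    forall_eq_apply_imp_iff, forall_eq, and_and_and_comm]

namespace Derivation

theorem mem_rules_and_fires (h : P.Derivation ι M rs) (hr : r ∈ rs) :
    r ∈ P.rules ∧ P.Fires ι M (heads rs) r := by
  obtain ⟨s, ts, rfl⟩ := List.append_of_mem hr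
  obtain ⟨hmem, hfires⟩ := h r ts (List.suffix_append ..)
  exact ⟨hmem, hfires.mono (heads_mono (by simp))⟩

theorem heads_subset (h : P.Derivation ι M rs) (hI : P.K ι M I ⊆ I) : heads rs ⊆ I := by
  induction rs with
  | nil => simp [heads]
  | cons r rs ih =>
    obtain ⟨⟨hr, hfires⟩, hrs⟩ := derivation_cons_iff.mp h
    rw [heads_cons]
    exact Set.insert_subset (hI (mem_K_iff.mpr ⟨r, hr, rfl, hfires.mono (ih hrs)⟩)) (ih hrs)

theorem heads_subset_K (h : P.Derivation ι M rs) : heads rs ⊆ P.K ι M (heads rs) := by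
  rintro _ ⟨r, hr, rfl⟩
  obtain ⟨hmem, hfires⟩ := h.mem_rules_and_fires hr
  exact mem_K_iff.mpr ⟨r, hmem, rfl, hfires⟩

theorem isFixpointAnswerSet (h : P.Derivation ι (heads rs) rs)
    (hK : P.K ι (heads rs) (heads rs) ⊆ heads rs) : P.IsFixpointAnswerSet ι (heads rs) :=
  ⟨⟨heads_subset_base fun _ hr => (h.mem_rules_and_fires hr).1, hK.antisymm h.heads_subset_K⟩,
    fun _ hI => h.heads_subset hI.2.le⟩

end Derivation

theorem IsFixpointAnswerSet.exists_derivation (h : P.IsFixpointAnswerSet ι M) :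
    ∃ rs, rs.Subperm P.rules ∧ P.Derivation ι M rs ∧ heads rs = M := by
  by_contra! hne
  -- A derivation without repetitions whose heads are not closed can be extended.
  have exists_length (n : ℕ) : ∃ rs : List Rule, rs.Nodup ∧ P.Derivation ι M rs ∧
      rs.length = n := by
    induction n with
    | zero => exact ⟨[], by simp [Derivation]⟩
    | succ n ih =>
      obtain ⟨rs, hnodup, hrs, rfl⟩ := ih
      have hrules : rs ⊆ P.rules := fun r hr => (hrs.mem_rules_and_fires hr).1
      have hclosed : ¬ P.K ι M (heads rs) ⊆ heads rs := fun hK =>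
        hne rs (hnodup.subperm hrules) hrs <| (hrs.heads_subset h.1.2.le).antisymm <|
          h.2 ⟨heads_subset_base hrules, hK.antisymm hrs.heads_subset_K⟩
      obtain ⟨_, haK, hnew⟩ := Set.not_subset.mp hclosed
      obtain ⟨r, hr, rfl, hfires⟩ := mem_K_iff.mp haK
      exact ⟨r :: rs, List.nodup_cons.mpr ⟨fun hmem => hnew ⟨r, hmem, rfl⟩, hnodup⟩,
        derivation_cons_iff.mpr ⟨⟨hr, hfires⟩, hrs⟩, rfl⟩
  obtain ⟨rs, hnodup, hrs, hlen⟩ := exists_length (P.rules.length + 1)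
  have := (hnodup.subperm fun r hr => (hrs.mem_rules_and_fires hr).1).length_le
  omega

/-- The interpretation `J` provides no evidence that the list of rules `rs` fails to be a
derivation with respect to its set of heads, or that this set is not closed under the rules. -/
def Passes (P : Program) (ι : AggInterp) (rs : List Rule) (J : Set Atom) : Prop :=
  (∀ r ts, r :: ts <:+ rs → heads ts ⊆ J → P.BodyHolds ι (heads rs) (heads ts) J r) ∧
    (heads rs ⊆ J → ∀ r ∈ P.rules, P.BodyHolds ι (heads rs) (heads rs) J r → r.head ∈ heads rs)

theorem forall_passes_iff (hrs : ∀ r ∈ rs, r ∈ P.rules) :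
    (∀ J ⊆ heads rs, P.Passes ι rs J) ↔
      P.Derivation ι (heads rs) rs ∧ P.K ι (heads rs) (heads rs) ⊆ heads rs := by
  have hbase := heads_subset_base hrs
  have hfires {r : Rule} {ts : List Rule} (h : r :: ts <:+ rs) :=
    fires_iff (ι := ι) (hrs r (h.subset (by simp)))
      (heads_mono ((List.suffix_cons r ts).trans h).subset) hbase
  constructor
  · refine fun h => ⟨fun r ts hts => ⟨hrs r (hts.subset (by simp)), (hfires hts).mpr
      fun J hJ hJM => (h J hJM).1 r ts hts hJ⟩, fun a ha => ?_⟩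
    obtain ⟨r, hr, rfl, hf⟩ := mem_K_iff.mp ha
    exact (h _ subset_rfl).2 subset_rfl r hr ((fires_self_iff hr hbase).mp hf)
  · rintro ⟨hder, hK⟩ J hJ
    refine ⟨fun r ts hts hJts => (hfires hts).mp (hder r ts hts).2 J hJts hJ,
      fun hJM r hr hbody => ?_⟩
    obtain rfl := hJ.antisymm hJM
    exact hK (mem_K_iff.mpr ⟨r, hr, rfl, (fires_self_iff hr hbase).mpr hbody⟩)

end Program

/-! ### Verification of certificates -/

namespace Sexp

section Codes

variable {α : Type} {f : α → Sexp} {l l' : List α} {x : Sexp}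

theorem toList_ofList (f : α → Sexp) (l : List α) : (ofList f l).toList = l.map f := by
  induction l with
  | nil => rfl
  | cons a l ih => simpa [ofList, toList] using ih

theorem exists_eq_ofList (h : ∀ y ∈ x.toList, y ∈ l.map f) :
    ∃ l' : List α, ofList f l' = x ∧ ∀ a ∈ l', a ∈ l := by
  induction x with
  | nil => exact ⟨[], rfl, by simp⟩
  | cons y x _ ih =>
    simp only [toList, List.forall_mem_cons] at h
    obtain ⟨a, ha, rfl⟩ := List.mem_map.mp h.1
    obtain ⟨l', rfl, hl'⟩ := ih h.2
    exact ⟨a :: l', rfl, List.forall_mem_cons.mpr ⟨ha, hl'⟩⟩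

theorem allTail_ofList_iff {p : Sexp → Prop} : (ofList f l).AllTail p ↔
    ∀ a t, a :: t <:+ l → p (cons (f a) (ofList f t)) := by
  induction l with
  | nil => simp [ofList, AllTail]
  | cons b l ih =>
    change p (cons (f b) (ofList f l)) ∧ (ofList f l).AllTail p ↔ _
    rw [ih]
    simp only [List.suffix_cons_iff, List.cons.injEq, or_imp, and_imp, forall_and,
      forall_eq_apply_imp_iff, forall_eq]

theorem size_ofList (f : α → Sexp) (l : List α) :
    (ofList f l).size = 1 + (l.map fun a => 1 + (f a).size).sum := by
  induction l with
  | nil => rfl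
  | cons a l ih =>
    change 1 + (f a).size + (ofList f l).size = _
    rw [ih, List.map_cons, List.sum_cons]
    omega

theorem size_ofList_le_of_subperm (f : α → Sexp) (h : l.Subperm l') :
    (ofList f l).size ≤ (ofList f l').size := by
  obtain ⟨k, hperm, hsub⟩ := h
  rw [size_ofList, size_ofList, ← (hperm.map _).sum_eq]
  exact Nat.add_le_add_left ((hsub.map _).sum_le_sum fun _ _ => Nat.zero_le _) 1

theorem ofList_injective (hf : f.Injective) : (ofList f).Injective := fun l l' h =>
  List.map_injective_iff.mpr hf <| by rw [← toList_ofList, ← toList_ofList, h]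

theorem ofBool_injective : ofBool.Injective := by
  intro a b
  cases a <;> cases b <;> simp [ofBool]

theorem ofNat_injective : ofNat.Injective := fun m n h =>
  Nat.digits.injective 2 <| by
    rw [Nat.digits_two_eq_bits, Nat.digits_two_eq_bits, ofList_injective ofBool_injective h]

theorem ofInt_injective : ofInt.Injective := fun m n h => by
  simp only [ofInt, cons.injEq] at h
  have hsign := decide_eq_decide.mp (ofBool_injective h.1)
  have hnatAbs := ofNat_injective h.2
  omega

theorem ofConst_injective : ofConst.Injective := by
  rintro (a | a) (b | b) h
  · rw [ofInt_injective (cons.inj h).2]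
  · simpa using ofBool_injective (cons.inj h).1
  · simpa using ofBool_injective (cons.inj h).1
  · rw [ofNat_injective (cons.inj h).2]

theorem ofAtom_injective : ofAtom.Injective := by
  rintro ⟨p, as⟩ ⟨q, bs⟩ h
  simp only [ofAtom, cons.injEq] at h
  rw [ofNat_injective h.1, ofList_injective ofConst_injective h.2]

theorem toList_rules_ofProgram (P : Program) :
    (ofProgram P).tl.tl.toList = P.rules.map ofRule :=
  toList_ofList ofRule P.rules

theorem size_ofList_rules_le (P : Program) :
    (ofList ofRule P.rules).size ≤ (ofProgram P).size :=
  (ofProgram P).tl.size_tl_le.trans (ofProgram P).size_tl_le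

end Codes

/-- `a` is the head of one of the coded rules in the list `w`. -/
def IsHead (a w : Sexp) : Prop := ∃ r ∈ w.toList, r.hd = a

/-- The list `u` consists of heads of coded rules in the list `w`. -/
def Within (u w : Sexp) : Prop := ∀ a ∈ u.toList, IsHead a w

/-- All heads of coded rules in the list `w` are in the list `u`. -/
def Covers (w u : Sexp) : Prop := ∀ r ∈ w.toList, r.hd ∈ u.toList

/-- `Program.BodyHolds` on codes, for the heads of the rules in the lists `w` and `t` and the
interpretation listed by `u`; the language `A` answers the questions about aggregate atoms. -/
def BodyHolds (A : Lang) (w t u r : Sexp) : Prop :=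
  (∀ b ∈ r.tl.tl.tl.toList, ¬ IsHead b w) ∧ (∀ b ∈ r.tl.tl.hd.toList, IsHead b t) ∧
    ∀ l ∈ r.tl.hd.toList, cons l u ∈ A

/-- `Program.Passes` on codes: the list `w` consists of rules of the program `x`, and it passes
the test posed by `u` if `u` lists an interpretation contained in the set of heads of `w`. -/
def Passes (A : Lang) (x w u : Sexp) : Prop :=
  (∀ r ∈ w.toList, r ∈ x.tl.tl.toList) ∧ (Within u w →
    (w.AllTail fun t => Covers t.tl u → BodyHolds A w t.tl u t.hd) ∧
      (Covers w u → ∀ r ∈ x.tl.tl.toList, BodyHolds A w w u r → IsHead r.hd w))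

section PolyDec

variable {O : Lang} {f g h k : Sexp → Sexp}

theorem polyDec_isHead (hf : PolyTime O f) (hg : PolyTime O g) :
    PolyDec O fun z => IsHead (f z) (g z) :=
  .exists_mem (p := fun r z => r.hd = f z) hg (.eq (.hd (.hd .id)) (hf.comp (.tl .id)))

theorem polyDec_within (hf : PolyTime O f) (hg : PolyTime O g) :
    PolyDec O fun z => Within (f z) (g z) :=
  .forall_mem (p := fun a z => IsHead a (g z)) hf (polyDec_isHead (.hd .id) (hg.comp (.tl .id)))

theorem polyDec_covers (hf : PolyTime O f) (hg : PolyTime O g) :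
    PolyDec O fun z => Covers (f z) (g z) :=
  .forall_mem (p := fun r z => r.hd ∈ (g z).toList) hf
    (.mem_toList (.hd (.hd .id)) (hg.comp (.tl .id)))

theorem polyDec_bodyHolds (hw : PolyTime O f) (ht : PolyTime O g) (hu : PolyTime O h)
    (hr : PolyTime O k) : PolyDec O fun z => BodyHolds O (f z) (g z) (h z) (k z) := by
  refine .and ?_ (.and ?_ ?_)
  · exact .forall_mem (p := fun b z => ¬ IsHead b (f z)) hr.tl.tl.tl
      (polyDec_isHead (.hd .id) (hw.comp (.tl .id))).not
  · exact .forall_mem (p := fun b z => IsHead b (g z)) hr.tl.tl.hd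
      (polyDec_isHead (.hd .id) (ht.comp (.tl .id)))
  · exact .forall_mem (p := fun l z => cons l (h z) ∈ O) hr.tl.hd
      (.query (.cons (.hd .id) (hu.comp (.tl .id))))

theorem polyDec_passes (O : Lang) : PolyDec O fun z => Passes O z.hd.hd z.hd.tl z.tl := by
  have hx : PolyTime O fun z => z.hd.hd := .hd (.hd .id)
  have hw : PolyTime O fun z => z.hd.tl := .tl (.hd .id)
  have hu : PolyTime O fun z => z.tl := .tl .id
  refine .and ?_ (.imp (polyDec_within hu hw) (.and ?_ (.imp (polyDec_covers hw hu) ?_)))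
  · exact .forall_mem (p := fun r z => r ∈ z.hd.hd.tl.tl.toList) hw
      (.mem_toList (.hd .id) (hx.comp hu).tl.tl)
  · exact .allTail (p := fun t z => Covers t.tl z.tl → BodyHolds O z.hd.tl t.tl z.tl t.hd) hw
      (.imp (polyDec_covers (.tl (.hd .id)) (hu.comp hu))
        (polyDec_bodyHolds (hw.comp hu) (.tl (.hd .id)) (hu.comp hu) (.hd (.hd .id))))
  · exact .forall_mem
      (p := fun r z => BodyHolds O z.hd.tl z.hd.tl z.tl r → IsHead r.hd z.hd.tl) hx.tl.tl
      (.imp (polyDec_bodyHolds (hw.comp hu) (hw.comp hu) (hu.comp hu) (.hd .id))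
        (polyDec_isHead (.hd (.hd .id)) (hw.comp hu)))

end PolyDec

section Correctness

open Program (heads)

variable {P : Program} {ι : AggInterp} {A : Lang} {r : Rule} {rs ts : List Rule}
  {us : List Atom} {a : Atom} {u : Sexp} {N : ℕ}

theorem isHead_ofList_iff : IsHead (ofAtom a) (ofList ofRule rs) ↔ a ∈ heads rs := by
  simp [IsHead, toList_ofList, heads, ofRule, ofAtom_injective.eq_iff]

theorem covers_ofList_iff :
    Covers (ofList ofRule rs) (ofList ofAtom us) ↔ heads rs ⊆ {a | a ∈ us} := by
  simp [Covers, toList_ofList, heads, ofRule, ofAtom_injective.eq_iff, Set.subset_def]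

theorem within_ofList_iff : Within u (ofList ofRule rs) ↔
    ∃ us : List Atom, ofList ofAtom us = u ∧ {a | a ∈ us} ⊆ heads rs := by
  constructor
  · intro h
    obtain ⟨us, rfl, hus⟩ := exists_eq_ofList (f := ofAtom) (l := rs.map Rule.head) (x := u) <| by
      simpa [Within, IsHead, toList_ofList, ofRule] using h
    exact ⟨us, rfl, fun a ha => List.mem_map.mp (hus a ha)⟩
  · rintro ⟨us, rfl, h⟩
    simpa [Within, toList_ofList, isHead_ofList_iff, Set.subset_def] using h

theorem exists_listing {J : Set Atom} (hJ : J ⊆ heads rs) : ∃ us : List Atom,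
    {a | a ∈ us} = J ∧ (ofList ofAtom us).size ≤ (ofList ofRule rs).size := by
  classical
  refine ⟨(rs.map Rule.head).filter (· ∈ J), ?_, ?_⟩
  · ext a
    simpa [heads] using fun ha => hJ ha
  · refine (size_ofList_le_of_subperm ofAtom List.filter_sublist.subperm).trans ?_
    rw [size_ofList, size_ofList, List.map_map]
    exact Nat.add_le_add_left
      (List.sum_le_sum fun r _ => Nat.add_le_add_left (ofRule r).size_hd_le 1) 1

theorem bodyHolds_ofRule_iff (hA : ∀ l, P.HasAgg l → P.AggDecidedBy ι A l) (hr : r ∈ P.rules)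
    (hus : {a | a ∈ us} ⊆ P.base) :
    BodyHolds A (ofList ofRule rs) (ofList ofRule ts) (ofList ofAtom us) (ofRule r) ↔
      P.BodyHolds ι (heads rs) (heads ts) {a | a ∈ us} r := by
  have hagg (l : AggAtom) (hl : l ∈ r.agg) :
      cons (ofAggAtom l) (ofList ofAtom us) ∈ A ↔ P.Sat ι {a | a ∈ us} l :=
    hA l ⟨r, hr, hl⟩ us hus
  simp +contextual only [BodyHolds, Program.BodyHolds, ofRule, hd_cons, tl_cons, toList_ofList,
    List.forall_mem_map, isHead_ofList_iff, hagg]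

theorem passes_ofList_iff (hA : ∀ l, P.HasAgg l → P.AggDecidedBy ι A l)
    (hrs : ∀ r ∈ rs, r ∈ P.rules) (hus : {a | a ∈ us} ⊆ heads rs) :
    Passes A (ofProgram P) (ofList ofRule rs) (ofList ofAtom us) ↔
      P.Passes ι rs {a | a ∈ us} := by
  have hbody {r : Rule} {ts : List Rule} (hr : r ∈ P.rules) :=
    bodyHolds_ofRule_iff (rs := rs) (ts := ts) hA hr
      (hus.trans (Program.heads_subset_base hrs))
  have hrules : ∀ r ∈ (ofList ofRule rs).toList, r ∈ (ofProgram P).tl.tl.toList := by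
    rw [toList_ofList, toList_rules_ofProgram]
    exact List.map_subset _ hrs
  rw [Passes, Program.Passes, and_iff_right hrules,
    imp_iff_right (within_ofList_iff.mpr ⟨us, rfl, hus⟩), allTail_ofList_iff]
  refine and_congr (forall₃_congr fun r ts hts => ?_) ?_
  · simp only [hd_cons, tl_cons, covers_ofList_iff, hbody (hrs r (hts.subset (by simp)))]
  · rw [covers_ofList_iff, toList_rules_ofProgram, List.forall_mem_map]
    refine imp_congr_right fun _ => forall₂_congr fun r hr => ?_
    rw [hbody hr, show (ofRule r).hd = ofAtom r.head from rfl, isHead_ofList_iff]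

theorem forall_passes_iff (hA : ∀ l, P.HasAgg l → P.AggDecidedBy ι A l)
    (hrs : ∀ r ∈ rs, r ∈ P.rules) (hN : (ofList ofRule rs).size ≤ N) :
    (∀ u : Sexp, u.size ≤ N → Passes A (ofProgram P) (ofList ofRule rs) u) ↔
      ∀ J ⊆ heads rs, P.Passes ι rs J := by
  constructor
  · intro h J hJ
    obtain ⟨us, rfl, hsize⟩ := exists_listing hJ
    exact (passes_ofList_iff hA hrs hJ).mp (h _ (hsize.trans hN))
  · intro h u _
    by_cases hu : Within u (ofList ofRule rs)
    · obtain ⟨us, rfl, hus⟩ := within_ofList_iff.mp hu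
      exact (passes_ofList_iff hA hrs hus).mpr (h _ hus)
    · refine ⟨?_, fun h => absurd h hu⟩
      rw [toList_ofList, toList_rules_ofProgram]
      exact List.map_subset _ hrs

theorem exists_certificate_iff (hA : ∀ l, P.HasAgg l → P.AggDecidedBy ι A l) :
    (∃ w : Sexp, w.size ≤ (ofProgram P).size ∧
      ∀ u : Sexp, u.size ≤ (cons (ofProgram P) w).size → Passes A (ofProgram P) w u) ↔
      ∃ M : Set Atom, P.IsFixpointAnswerSet ι M := by
  have hN (w : Sexp) : w.size ≤ (cons (ofProgram P) w).size := size_tl_le (cons _ w)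
  constructor
  · rintro ⟨w, -, h⟩
    obtain ⟨rs, rfl, hrs⟩ := exists_eq_ofList (x := w) (l := P.rules) (f := ofRule) <| by
      rw [← toList_rules_ofProgram]
      exact (h _ (hN w)).1
    obtain ⟨hder, hK⟩ := (Program.forall_passes_iff hrs).mp ((forall_passes_iff hA hrs (hN _)).mp h)
    exact ⟨_, hder.isFixpointAnswerSet hK⟩
  · rintro ⟨M, hM⟩
    obtain ⟨rs, hsub, hder, rfl⟩ := hM.exists_derivation
    exact ⟨ofList ofRule rs, (size_ofList_le_of_subperm ofRule hsub).trans (size_ofList_rules_le P),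
      (forall_passes_iff hA hsub.subset (hN _)).mpr
        ((Program.forall_passes_iff hsub.subset).mpr ⟨hder, hM.1.2.le⟩)⟩

end Correctness

end Sexp

/-- The answer set existence problem for `𝒞`-decidable programs is in `NP^(co-NP^𝒞)`. -/
theorem mainTheorem9 (ι : AggInterp) (𝒞 : Set Lang) (𝒬 : Set Program)
    (h𝒬 : ClassDecidable ι 𝒞 𝒬) :
    ProblemIn (NPRel (coNPRel 𝒞)) 𝒬 (fun P => ∃ M : Set Atom, P.IsFixpointAnswerSet ι M) := by
  obtain ⟨A, hA, hdec⟩ := h𝒬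
  refine ⟨_, mem_NPRel_coNPRel hA (Sexp.polyDec_passes A) .X .X, fun P hP => ?_⟩
  simpa using Sexp.exists_certificate_iff (hdec P hP)
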